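/- Let $k\ge 2$ and $d\ge 1$ be integers, and let $G=C_{2k}^d$ be the $d$-th power of the Cartesian product of the even cycle $C_{2k}$ with itself, i.e. the graph whose vertices are the $d$-tuples of vertices of $C_{2k}$, two of them being adjacent if and only if they are adjacent in $C_{2k}$ in one coordinate and equal in all other coordinates. Let $E'\subseteq E(G)$ be a set of at most $2d-1$ edges, and let $\varphi:E'\to\{1,\dots,2d\}$ be proper, i.e. any two distinct edges of $E'$ with a common endpoint receive different colors under $\varphi$. Then there is a proper edge coloring $f:E(G)\to\{1,\dots,2d\}$ of $G$ such that $f(e)=\varphi(e)$ for every $e\in E'$. -/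

import Mathlib

namespace EdgePrecoloring

/-- The `d`-th power of the Cartesian product of `G` with itself: the vertices are the `d`-tuples of
vertices of `G`; two of them are adjacent iff they are adjacent in `G` in one coordinate and
equal in all the others. -/
def cartesianPower {V : Type*} (G : SimpleGraph V) (d : ℕ) : SimpleGraph (Fin d → V) where
  Adj x y := ∃ i, G.Adj (x i) (y i) ∧ ∀ j, j ≠ i → x j = y j
  symm := ⟨fun _ _ ⟨i, h, h'⟩ => ⟨i, h.symm, fun j hj => (h' j hj).symm⟩⟩
  loopless := ⟨fun _ ⟨_, h, _⟩ => h.ne rfl⟩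

/-- The first power is the graph itself. -/
def cartesianPowerOne {V : Type*} (G : SimpleGraph V) : cartesianPower G 1 ≃g G where
  toEquiv := Equiv.funUnique (Fin 1) V
  map_rel_iff' := by
    intro x y
    simp [cartesianPower, Subsingleton.elim _ (0 : Fin 1)]

/-- The powers are the iterated (binary) Cartesian products. -/
def cartesianPowerSucc {V : Type*} (G : SimpleGraph V) (d : ℕ) :
    cartesianPower G (d + 1) ≃g G.boxProd (cartesianPower G d) where
  toEquiv := (Fin.consEquiv fun _ => V).symm
  map_rel_iff' := by
    intro x y
    simp only [cartesianPower, SimpleGraph.boxProd_adj, Fin.consEquiv, Equiv.coe_fn_symm_mk]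
    rw [Fin.exists_fin_succ]
    refine or_congr (and_congr_right fun _ => ?_) ?_
    · simp [Fin.forall_fin_succ, funext_iff, Fin.tail]
    · simp only [Fin.forall_fin_succ, ne_eq, Fin.succ_inj, Fin.tail]
      constructor
      · rintro ⟨⟨i, h, h'⟩, h0⟩
        exact ⟨i, h, fun _ => h0, h'⟩
      · rintro ⟨i, h, h0, h'⟩
        exact ⟨⟨i, h, h'⟩, h0 (Fin.succ_ne_zero i).symm⟩

/-- The restriction of `f` to the set `E` of edges is a proper coloring of `E`: distinct
edges of `E` with a common endpoint receive different colors. Values outside `E` are ignored. -/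
def IsProperOn {V C : Type*} (E : Set (Sym2 V)) (f : Sym2 V → C) : Prop :=
  ∀ e ∈ E, ∀ e' ∈ E, e ≠ e' → (∃ v, v ∈ e ∧ v ∈ e') → f e ≠ f e'

/-- `φ` is a `t`-edge precoloring (partial edge coloring) of `G` whose set of precolored edges
is `E`. -/
def IsPrecoloring {V : Type*} (G : SimpleGraph V) {t : ℕ} (E : Set (Sym2 V))
    (φ : Sym2 V → Fin t) : Prop :=
  E ⊆ G.edgeSet ∧ IsProperOn E φ

/-- The precoloring `φ` of the edges in `E` is extendable: some proper `t`-edge coloring of the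
whole graph `G` agrees with `φ` on `E`. -/
def IsExtendable {V : Type*} (G : SimpleGraph V) {t : ℕ} (E : Set (Sym2 V))
    (φ : Sym2 V → Fin t) : Prop :=
  ∃ f : Sym2 V → Fin t, IsProperOn G.edgeSet f ∧ ∀ e ∈ E, f e = φ e

end EdgePrecoloring

/-! The edges of the graph split into `2 * d` perfect matchings, two per coordinate, each given by
an involution. The claim is generalized to any n of them, n colors and at most n - 1 demands
(`exists_isMatchingColoring`), by induction on n. Some matching i and some color c are not demanded;
remove both. Without i, its coordinate is joined only along the other involution, so the graph falls
apart into slabs. If no slab holds too many demands for the induction hypothesis, color the slabs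
separately and give i the color c. Otherwise all demands lie in one slab. Satisfy all but one by
induction, then force the last by a local swap in which i absorbs the freed colors (`recolor`). This
may color the two ends of an i-edge differently, so the whole graph is folded onto that slab,
collapsing every i-edge to a point, and the coloring is pulled back. -/

namespace EdgePrecoloring

/-! ### Colorings of unions of matchings -/

section Flip

variable {X Col : Type*} {d : ℕ}

/-- The involution `inv r.2` applied in the coordinate `r.1`. -/
def flip (inv : Bool → X → X) (r : Fin d × Bool) (x : Fin d → X) : Fin d → X :=
  Function.update x r.1 (inv r.2 (x r.1))

/-- `F v r` is the color of the edge `{v, flip inv r v}`; the coloring uses colors from `C` and is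
proper on the union of the matchings with index in `A`. -/
structure IsMatchingColoring (inv : Bool → X → X) (A : Finset (Fin d × Bool)) (C : Finset Col)
    (F : (Fin d → X) → Fin d × Bool → Col) : Prop where
  mem : ∀ v, ∀ r ∈ A, F v r ∈ C
  inj : ∀ v, ∀ r ∈ A, ∀ s ∈ A, F v r = F v s → r = s
  flip : ∀ v, ∀ r ∈ A, F (flip inv r v) r = F v r

/-- The edges `{v, flip inv r v}` and `{w, flip inv s w}` have a common endpoint. -/
def Touch (inv : Bool → X → X) (v : Fin d → X) (r : Fin d × Bool) (w : Fin d → X)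
    (s : Fin d × Bool) : Prop :=
  (v = w ∨ v = flip inv s w) ∨ flip inv r v = w ∨ flip inv r v = flip inv s w

/-- A set of demands `(v, r, a)`, meaning that `{v, flip inv r v}` has color `a`, is a proper
partial coloring. -/
def Compatible (inv : Bool → X → X) (E : Finset ((Fin d → X) × (Fin d × Bool) × Col)) : Prop :=
  ∀ e ∈ E, ∀ e' ∈ E, Touch inv e.1 e.2.1 e'.1 e'.2.1 → (e.2.1 = e'.2.1 ↔ e.2.2 = e'.2.2)

variable {inv : Bool → X → X}

theorem flip_flip (hinv : ∀ s x, inv s (inv s x) = x) (r : Fin d × Bool) (x : Fin d → X) :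
    flip inv r (flip inv r x) = x := by
  simp [flip, hinv]

theorem flip_ne (hne : ∀ s x, inv s x ≠ x) (r : Fin d × Bool) (x : Fin d → X) :
    flip inv r x ≠ x := by
  intro h
  have := congrFun h r.1
  simp [flip, hne] at this

theorem flip_injective_index (hne : ∀ s x, inv s x ≠ x) (hne' : ∀ s x, inv (!s) x ≠ inv s x)
    {r s : Fin d × Bool} {x : Fin d → X} (h : flip inv r x = flip inv s x) : r = s := by
  obtain ⟨i, p⟩ := r
  obtain ⟨j, q⟩ := s
  have hi := congrFun h i
  by_cases hij : i = j
  · subst hij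
    simp only [flip, Function.update_self] at hi
    have h1 := hne' p (x i)
    cases p <;> cases q <;> simp_all
  · simp [flip, hij, hne] at hi

/-- Use a new color on a new matching. -/
theorem IsMatchingColoring.extend [DecidableEq Col] {A : Finset (Fin d × Bool)} {C : Finset Col}
    {F : (Fin d → X) → Fin d × Bool → Col} {i : Fin d × Bool} {c : Col} (hc : c ∈ C)
    (hF : IsMatchingColoring inv (A.erase i) (C.erase c) F) :
    IsMatchingColoring inv A C (fun v r => if r = i then c else F v r) := by
  refine ⟨fun v r hr => ?_, fun v r hr s hs h => ?_, fun v r hr => ?_⟩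
  · split_ifs with h
    · exact hc
    · exact Finset.mem_of_mem_erase (hF.mem v r (Finset.mem_erase.2 ⟨h, hr⟩))
  · beta_reduce at h
    split_ifs at h with h1 h2 h2
    · rw [h1, h2]
    · exact absurd h.symm (Finset.ne_of_mem_erase (hF.mem v s (Finset.mem_erase.2 ⟨h2, hs⟩)))
    · exact absurd h (Finset.ne_of_mem_erase (hF.mem v r (Finset.mem_erase.2 ⟨h1, hr⟩)))
    · exact hF.inj v r (Finset.mem_erase.2 ⟨h1, hr⟩) s (Finset.mem_erase.2 ⟨h2, hs⟩) h
  · split_ifs with h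
    · rfl
    · exact hF.flip v r (Finset.mem_erase.2 ⟨h, hr⟩)

open Classical in
/-- Recolor around the edge `{u, flip inv l u}` of color `F u l` so that it gets the color `a`.
The new color `c` replaces `a` on the edges adjacent to it, and the matching `i` absorbs the
changes. -/
noncomputable def recolor (inv : Bool → X → X) (A : Finset (Fin d × Bool))
    (F : (Fin d → X) → Fin d × Bool → Col) (u : Fin d → X) (l i : Fin d × Bool) (a c : Col)
    (y : Fin d → X) (r : Fin d × Bool) : Col :=
  if r = i then
    if y = u ∨ y = flip inv l u then F u l
    else if ∃ s ∈ A.erase i, F y s = a ∧ (flip inv s y = u ∨ flip inv s y = flip inv l u) then a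
    else c
  else if r = l ∧ (y = u ∨ y = flip inv l u) then a
  else if F y r = a ∧ ((y = u ∨ y = flip inv l u) ∨
    flip inv r y = u ∨ flip inv r y = flip inv l u) then c
  else F y r

section Recolor

variable [DecidableEq Col] {A : Finset (Fin d × Bool)} {C : Finset Col}
  {F : (Fin d → X) → Fin d × Bool → Col} {u : Fin d → X} {l i : Fin d × Bool} {a c : Col}

theorem recolor_mem (hc : c ∈ C) (ha : a ∈ C) (hl : l ∈ A.erase i)
    (hF : IsMatchingColoring inv (A.erase i) (C.erase c) F) (y : Fin d → X) {r : Fin d × Bool}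
    (hr : r ∈ A) : recolor inv A F u l i a c y r ∈ C := by
  have h1 := Finset.mem_of_mem_erase (hF.mem u l hl)
  unfold recolor
  split_ifs with h
  any_goals assumption
  exact Finset.mem_of_mem_erase (hF.mem y r (Finset.mem_erase.2 ⟨h, hr⟩))

/-- At each vertex, i receives a color left free by the other matchings: the old color of l at the
two ends of the forced edge, a at the far end of an edge changed from a to c, and c elsewhere. -/
theorem recolor_inj (hl : l ∈ A.erase i) (hac : a ≠ c) (hab : F u l ≠ a)
    (hF : IsMatchingColoring inv (A.erase i) (C.erase c) F) (y : Fin d → X)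
    {r s : Fin d × Bool} (hr : r ∈ A) (hs : s ∈ A)
    (h : recolor inv A F u l i a c y r = recolor inv A F u l i a c y s) : r = s := by
  have hrr := fun hri : r ≠ i => Finset.mem_erase.2 ⟨hri, hr⟩
  have hss := fun hsi : s ≠ i => Finset.mem_erase.2 ⟨hsi, hs⟩
  have hFr : r ≠ i → F y r ≠ c := fun hri => Finset.ne_of_mem_erase (hF.mem y r (hrr hri))
  have hFs : s ≠ i → F y s ≠ c := fun hsi => Finset.ne_of_mem_erase (hF.mem y s (hss hsi))
  have hFl : F u l ≠ c := Finset.ne_of_mem_erase (hF.mem u l hl)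
  have hinj : r ≠ i → s ≠ i → F y r = F y s → r = s :=
    fun hri hsi => hF.inj y r (hrr hri) s (hss hsi)
  have hrl : r ≠ i → F y r = F y l → r = l := fun hri => hF.inj y r (hrr hri) l hl
  have hsl : s ≠ i → F y s = F y l → s = l := fun hsi => hF.inj y s (hss hsi) l hl
  have hN : (y = u ∨ y = flip inv l u) → F y l = F u l := by
    rintro (rfl | rfl)
    · rfl
    · exact hF.flip u l hl
  have hra : r ≠ i → F y r = a → ¬ (F y r = a ∧ ((y = u ∨ y = flip inv l u) ∨
      flip inv r y = u ∨ flip inv r y = flip inv l u)) → ¬ (y = u ∨ y = flip inv l u) ∧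
      ¬ ∃ s ∈ A.erase i, F y s = a ∧ (flip inv s y = u ∨ flip inv s y = flip inv l u) := by
    rintro hri h1 h2
    refine ⟨fun h3 => h2 ⟨h1, Or.inl h3⟩, ?_⟩
    rintro ⟨q, hq, hqa, h3⟩
    obtain rfl := hF.inj y q hq r (hrr hri) (hqa.trans h1.symm)
    exact h2 ⟨h1, Or.inr h3⟩
  have hsa : s ≠ i → F y s = a → ¬ (F y s = a ∧ ((y = u ∨ y = flip inv l u) ∨
      flip inv s y = u ∨ flip inv s y = flip inv l u)) → ¬ (y = u ∨ y = flip inv l u) ∧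
      ¬ ∃ s ∈ A.erase i, F y s = a ∧ (flip inv s y = u ∨ flip inv s y = flip inv l u) := by
    rintro hsi h1 h2
    refine ⟨fun h3 => h2 ⟨h1, Or.inl h3⟩, ?_⟩
    rintro ⟨q, hq, hqa, h3⟩
    obtain rfl := hF.inj y q hq s (hss hsi) (hqa.trans h1.symm)
    exact h2 ⟨h1, Or.inr h3⟩
  have hrc : r ≠ i → (F y r = a ∧ ((y = u ∨ y = flip inv l u) ∨
      flip inv r y = u ∨ flip inv r y = flip inv l u)) → ¬ (y = u ∨ y = flip inv l u) →
      ∃ s ∈ A.erase i, F y s = a ∧ (flip inv s y = u ∨ flip inv s y = flip inv l u) :=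
    fun hri h1 h2 => ⟨r, hrr hri, h1.1, h1.2.resolve_left h2⟩
  have hsc : s ≠ i → (F y s = a ∧ ((y = u ∨ y = flip inv l u) ∨
      flip inv s y = u ∨ flip inv s y = flip inv l u)) → ¬ (y = u ∨ y = flip inv l u) →
      ∃ s ∈ A.erase i, F y s = a ∧ (flip inv s y = u ∨ flip inv s y = flip inv l u) :=
    fun hsi h1 h2 => ⟨s, hss hsi, h1.1, h1.2.resolve_left h2⟩
  classical
  unfold recolor at h
  -- With the neighborhood conditions made opaque, a finite case check remains.
  obtain ⟨P, hP⟩ : ∃ P : Prop, P ↔ ∃ s ∈ A.erase i, F y s = a ∧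
    (flip inv s y = u ∨ flip inv s y = flip inv l u) := ⟨_, Iff.rfl⟩
  obtain ⟨N, hNN⟩ : ∃ N : Prop, N ↔ (y = u ∨ y = flip inv l u) := ⟨_, Iff.rfl⟩
  obtain ⟨Nr, hNr⟩ : ∃ N : Prop, N ↔ (flip inv r y = u ∨ flip inv r y = flip inv l u) :=
    ⟨_, Iff.rfl⟩
  obtain ⟨Ns, hNs⟩ : ∃ N : Prop, N ↔ (flip inv s y = u ∨ flip inv s y = flip inv l u) :=
    ⟨_, Iff.rfl⟩
  simp only [← hP, ← hNN, ← hNr, ← hNs] at h hN hra hsa hrc hsc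
  clear hP hNN hNr hNs
  clear hF hrr hss
  grind

theorem recolor_flip (hinv : ∀ s x, inv s (inv s x) = x) (hab : F u l ≠ a) (hl : l ∈ A.erase i)
    (hF : IsMatchingColoring inv (A.erase i) (C.erase c) F) (y : Fin d → X)
    {r : Fin d × Bool} (hr : r ∈ A.erase i) :
    recolor inv A F u l i a c (flip inv r y) r = recolor inv A F u l i a c y r := by
  have hri := Finset.ne_of_mem_erase hr
  have hf := hF.flip y r hr
  have hlN : (flip inv l y = u ∨ flip inv l y = flip inv l u) ↔ (y = u ∨ y = flip inv l u) := by
    have h1 : flip inv l y = u ↔ y = flip inv l u :=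
      ⟨fun h => by rw [← h, flip_flip hinv], fun h => by rw [h, flip_flip hinv]⟩
    have h2 : flip inv l y = flip inv l u ↔ y = u :=
      ⟨fun h => by rw [← flip_flip hinv l y, h, flip_flip hinv], fun h => by rw [h]⟩
    rw [h1, h2, or_comm]
  classical
  unfold recolor
  rw [if_neg hri, if_neg hri, hf, flip_flip hinv]
  by_cases h : r = l
  · subst h
    simp only [eq_self, true_and, hlN, or_self]
  · simp only [h, false_and, if_false]
    congr 2
    exact propext or_comm

end Recolor

/-! ### Folding onto a slab -/

open Classical in
/-- A map onto the pair `{t, inv (!s) t}` that identifies the pairs `{x, inv s x}`. -/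
noncomputable def fold (inv : Bool → X → X) (s : Bool) (t x : X) : X :=
  if x = t ∨ x = inv s t then t else inv (!s) t

theorem fold_inv (hinv : ∀ s x, inv s (inv s x) = x) (s : Bool) (t x : X) :
    fold inv s t (inv s x) = fold inv s t x := by
  have h1 : inv s x = t ↔ x = inv s t :=
    ⟨fun h => by rw [← h, hinv], fun h => by rw [h, hinv]⟩
  have h2 : inv s x = inv s t ↔ x = t :=
    ⟨fun h => by rw [← hinv s x, h, hinv], fun h => by rw [h]⟩
  classical
  simp only [fold, h1, h2]
  exact if_congr or_comm rfl rfl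

theorem fold_eq_self (hne : ∀ s x, inv s x ≠ x) (hne' : ∀ s x, inv (!s) x ≠ inv s x) {s : Bool}
    {t x : X} (h : x = t ∨ x = inv (!s) t) : fold inv s t x = x := by
  rcases h with rfl | rfl
  · simp [fold]
  · simp [fold, hne, hne']

theorem fold_inv_not (hinv : ∀ s x, inv s (inv s x) = x) (s : Bool) (t x y : X) :
    fold inv s t y = fold inv s t x ∨ fold inv s t y = inv (!s) (fold inv s t x) := by
  unfold fold
  split_ifs <;> simp [hinv]

/-- Apply `fold` in one coordinate. -/
noncomputable def foldAt (inv : Bool → X → X) (i : Fin d × Bool) (t : X) (x : Fin d → X) :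
    Fin d → X :=
  Function.update x i.1 (fold inv i.2 t (x i.1))

theorem foldAt_flip_self (hinv : ∀ s x, inv s (inv s x) = x) (i : Fin d × Bool) (t : X)
    (x : Fin d → X) : foldAt inv i t (flip inv i x) = foldAt inv i t x := by
  simp [foldAt, flip, fold_inv hinv]

/-- Either outcome keeps a pulled-back color the same at both ends of an r-edge. -/
theorem foldAt_flip (hinv : ∀ s x, inv s (inv s x) = x) {i r : Fin d × Bool} (hr : r ≠ i) (t : X)
    (x : Fin d → X) : foldAt inv i t (flip inv r x) = foldAt inv i t x ∨
      foldAt inv i t (flip inv r x) = flip inv r (foldAt inv i t x) := by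
  obtain ⟨i, s⟩ := i
  obtain ⟨j, q⟩ := r
  by_cases h : j = i
  · subst h
    have hq : q = !s := by cases q <;> cases s <;> simp_all
    subst hq
    rcases fold_inv_not hinv s t (x j) (inv (!s) (x j)) with h | h
    · left; simp [foldAt, flip, h]
    · right; simp [foldAt, flip, h]
  · right
    simp only [foldAt, flip, Function.update_of_ne h, Function.update_of_ne (Ne.symm h)]
    rw [Function.update_comm h]

/-- Fewer demands than matchings can be satisfied. -/
theorem exists_isMatchingColoring [DecidableEq Col] [Nonempty Col]
    (hinv : ∀ s x, inv s (inv s x) = x) (hne : ∀ s x, inv s x ≠ x)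
    (hne' : ∀ s x, inv (!s) x ≠ inv s x) (n : ℕ) :
    ∀ (A : Finset (Fin d × Bool)) (C : Finset Col)
      (E : Finset ((Fin d → X) × (Fin d × Bool) × Col)), A.card = n → C.card = n →
      E.card ≤ n - 1 → (∀ e ∈ E, e.2.1 ∈ A) → (∀ e ∈ E, e.2.2 ∈ C) → Compatible inv E →
      ∃ F, IsMatchingColoring inv A C F ∧ ∀ e ∈ E, F e.1 e.2.1 = e.2.2 := by
  classical
  induction n with
  | zero =>
    intro A C E hA _ hE _ _ _
    rw [Finset.card_eq_zero.1 hA, Finset.card_eq_zero.1 (Nat.le_zero.1 hE)]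
    exact ⟨fun _ _ => Classical.arbitrary Col, ⟨by simp, by simp, by simp⟩, by simp⟩
  | succ n ih =>
    intro A C E hA hC hE hEA hEC hcomp
    rw [Nat.add_sub_cancel] at hE
    obtain ⟨i, hi, hiE⟩ : ∃ i ∈ A, i ∉ E.image (fun e => e.2.1) :=
      Finset.exists_mem_notMem_of_card_lt_card
        (by have := Finset.card_image_le (s := E) (f := fun e => e.2.1); omega)
    obtain ⟨c, hc, hcE⟩ : ∃ c ∈ C, c ∉ E.image (fun e => e.2.2) :=
      Finset.exists_mem_notMem_of_card_lt_card
        (by have := Finset.card_image_le (s := E) (f := fun e => e.2.2); omega)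
    have hEi : ∀ e ∈ E, e.2.1 ≠ i := fun e he h => hiE (Finset.mem_image.2 ⟨e, he, h⟩)
    have hEc : ∀ e ∈ E, e.2.2 ≠ c := fun e he h => hcE (Finset.mem_image.2 ⟨e, he, h⟩)
    have hA' : (A.erase i).card = n := by rw [Finset.card_erase_of_mem hi, hA]; rfl
    have hC' : (C.erase c).card = n := by rw [Finset.card_erase_of_mem hc, hC]; rfl
    -- The hypotheses on S sit after the existential so that `choose` yields one coloring per demand
    -- set.
    have ih' : ∀ S : Finset ((Fin d → X) × (Fin d × Bool) × Col), ∃ F, S ⊆ E → S.card ≤ n - 1 →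
        IsMatchingColoring inv (A.erase i) (C.erase c) F ∧ ∀ e ∈ S, F e.1 e.2.1 = e.2.2 := by
      intro S
      by_cases h : S ⊆ E ∧ S.card ≤ n - 1
      · obtain ⟨F, hF⟩ := ih (A.erase i) (C.erase c) S hA' hC' h.2
          (fun e he => Finset.mem_erase.2 ⟨hEi e (h.1 he), hEA e (h.1 he)⟩)
          (fun e he => Finset.mem_erase.2 ⟨hEc e (h.1 he), hEC e (h.1 he)⟩)
          (fun e he e' he' => hcomp e (h.1 he) e' (h.1 he'))
        exact ⟨F, fun _ _ => hF⟩
      · exact ⟨fun _ _ => Classical.arbitrary Col, fun h1 h2 => absurd ⟨h1, h2⟩ h⟩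
    have extend : (∃ F, IsMatchingColoring inv (A.erase i) (C.erase c) F ∧
        ∀ e ∈ E, F e.1 e.2.1 = e.2.2) →
        ∃ F, IsMatchingColoring inv A C F ∧ ∀ e ∈ E, F e.1 e.2.1 = e.2.2 := by
      rintro ⟨F, hF, hFE⟩
      refine ⟨_, hF.extend hc, fun e he => ?_⟩
      rw [if_neg (hEi e he), hFE e he]
    let cls : X → Finset ((Fin d → X) × (Fin d × Bool) × Col) := fun t =>
      E.filter fun e => t = e.1 i.1 ∨ t = inv (!i.2) (e.1 i.1)
    by_cases hsplit : ∀ t, (cls t).card ≤ n - 1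
    · apply extend
      choose g hg using ih'
      have hg' := fun t => hg (cls t) (Finset.filter_subset _ _) (hsplit t)
      -- The coloring used at v depends only on its slab, which no remaining matching leaves.
      refine ⟨fun v => g (cls (v i.1)) v, ⟨fun v => (hg' _).1.mem v, fun v => (hg' _).1.inj v,
        fun v r hr => ?_⟩, fun e he => (hg' _).2 e (Finset.mem_filter.2 ⟨he, Or.inl rfl⟩)⟩
      have hcls : cls (flip inv r v i.1) = cls (v i.1) := by
        by_cases h : r.1 = i.1
        · have h2 : r.2 = !i.2 := by
            have := Finset.ne_of_mem_erase hr
            by_contra h2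
            exact this (Prod.ext h (by simpa using h2))
          have h3 : flip inv r v i.1 = inv (!i.2) (v i.1) := by
            rw [flip, h, Function.update_self, h2]
          rw [h3]
          refine Finset.filter_congr fun e _ => ?_
          constructor
          · rintro (h | h)
            · right; rw [← h, hinv]
            · left; rw [← hinv (!i.2) (v i.1), h, hinv]
          · rintro (h | h)
            · right; rw [← h]
            · left; rw [h, hinv]
        · rw [flip, Function.update_of_ne (Ne.symm h)]
      rw [hcls]
      exact (hg' _).1.flip v r hr
    · push Not at hsplit
      obtain ⟨t, ht⟩ := hsplit
      have hsub : cls t ⊆ E := Finset.filter_subset _ _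
      have hcl : cls t = E := Finset.eq_of_subset_of_card_le hsub (by omega)
      have hfix : ∀ e ∈ E, foldAt inv i t e.1 = e.1 := by
        intro e he
        rw [← hcl] at he
        rw [foldAt, fold_eq_self hne hne', Function.update_eq_self]
        rcases (Finset.mem_filter.1 he).2 with h | h
        · exact Or.inl h.symm
        · right; rw [h, hinv]
      obtain ⟨⟨u, l, a⟩, he⟩ : E.Nonempty := by
        rw [← Finset.card_pos, ← hcl]; omega
      obtain ⟨F, hF⟩ := ih' (E.erase (u, l, a))
      obtain ⟨hF, hFE⟩ := hF (Finset.erase_subset _ _)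
        (by rw [Finset.card_erase_of_mem he]; omega)
      by_cases hab : F u l = a
      · refine extend ⟨F, hF, fun e he' => ?_⟩
        by_cases h : e = (u, l, a)
        · rw [h]; exact hab
        · exact hFE e (Finset.mem_erase.2 ⟨h, he'⟩)
      have hl : l ∈ A.erase i := Finset.mem_erase.2 ⟨hEi _ he, hEA _ he⟩
      refine ⟨fun x => recolor inv A F u l i a c (foldAt inv i t x),
        ⟨fun v r hr => recolor_mem hc (hEC _ he) hl hF _ hr,
         fun v r hr s hs => recolor_inj hl (hEc _ he) hab hF _ hr hs, fun v r hr => ?_⟩, ?_⟩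
      · by_cases hri : r = i
        · rw [hri, foldAt_flip_self hinv]
        · rcases foldAt_flip hinv hri t v with h | h
          · rw [h]
          · rw [h, recolor_flip hinv hab hl hF _ (Finset.mem_erase.2 ⟨hri, hr⟩)]
      · rintro ⟨v, r, b⟩ he'
        have hT := hcomp _ he' _ he
        have hri := hEi _ he'
        have hv := hfix _ he'
        dsimp only at hT hri hv ⊢
        rw [hv]
        unfold recolor
        rw [if_neg hri]
        by_cases h : ((v, r, b) : (Fin d → X) × (Fin d × Bool) × Col) = (u, l, a)
        · simp only [Prod.mk.injEq] at h
          obtain ⟨rfl, rfl, rfl⟩ := h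
          simp
        have hFv : F v r = b := hFE _ (Finset.mem_erase.2 ⟨h, he'⟩)
        -- Another demand survives: if it touches the forced edge and has color a, compatibility
        -- makes it that same edge.
        split_ifs with h1 h2
        · exact ((hT (Or.inl h1.2)).1 h1.1).symm
        · obtain rfl := (hT h2.2).2 (hFv.symm.trans h2.1)
          refine absurd ⟨rfl, ?_⟩ h1
          rcases h2.2 with h3 | h3 | h3
          · exact h3
          · right; rw [← h3, flip_flip hinv]
          · left; rw [← flip_flip hinv r v, h3, flip_flip hinv]
        · exact hFv

end Flip

/-! ### The two perfect matchings of an even cycle -/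

section Cycle

/-- The two perfect matchings of the cycle on `Fin n` for even `n`. -/
def cycleInv {n : ℕ} (s : Bool) (x : Fin n) : Fin n :=
  if x.1 % 2 = s.toNat then ⟨if x.1 + 1 = n then 0 else x.1 + 1, by split_ifs <;> omega⟩
  else ⟨if x.1 = 0 then n - 1 else x.1 - 1, by split_ifs <;> omega⟩

theorem cycleInv_val {n : ℕ} (s : Bool) (x : Fin n) : (cycleInv s x).1 =
    if x.1 % 2 = s.toNat then (if x.1 + 1 = n then 0 else x.1 + 1)
    else (if x.1 = 0 then n - 1 else x.1 - 1) := by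
  unfold cycleInv
  split_ifs <;> rfl

variable {k : ℕ}

theorem cycleInv_cycleInv (s : Bool) (x : Fin (2 * k)) : cycleInv s (cycleInv s x) = x := by
  have := x.2
  have h1 := cycleInv_val s x
  have h2 := cycleInv_val s (cycleInv s x)
  apply Fin.ext
  cases s <;> simp only [Bool.toNat_false, Bool.toNat_true] at h1 h2 <;> split_ifs at h1 h2 <;>
    omega

theorem cycleInv_ne (hk : 2 ≤ k) (s : Bool) (x : Fin (2 * k)) : cycleInv s x ≠ x := by
  have := x.2
  rw [Ne, Fin.ext_iff, cycleInv_val]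
  cases s <;> simp only [Bool.toNat_false, Bool.toNat_true] <;> split_ifs <;> omega

/-- For k = 1 the two matchings coincide. -/
theorem cycleInv_not_ne (hk : 2 ≤ k) (s : Bool) (x : Fin (2 * k)) :
    cycleInv (!s) x ≠ cycleInv s x := by
  have := x.2
  rw [Ne, Fin.ext_iff, cycleInv_val, cycleInv_val]
  cases s <;> simp only [Bool.toNat_false, Bool.toNat_true, Bool.not_false, Bool.not_true] <;>
    split_ifs <;> omega

theorem cycleGraph_adj_iff (hk : 2 ≤ k) (x y : Fin (2 * k)) :
    (SimpleGraph.cycleGraph (2 * k)).Adj x y ↔ ∃ s, y = cycleInv s x := by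
  have hx := x.2
  have hy := y.2
  have h1 : ∀ a b : Fin (2 * k), (a - b).1 =
      if b.1 ≤ a.1 then a.1 - b.1 else 2 * k + a.1 - b.1 := by
    intro a b
    have := a.2
    have := b.2
    rw [Fin.sub_def]
    dsimp only
    split_ifs
    · rw [show 2 * k - b.1 + a.1 = (a.1 - b.1) + 2 * k by omega, Nat.add_mod_right,
        Nat.mod_eq_of_lt (by omega)]
    · rw [Nat.mod_eq_of_lt (by omega)]; omega
  rw [SimpleGraph.cycleGraph_adj', h1, h1, Bool.exists_bool, Fin.ext_iff, Fin.ext_iff,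
    cycleInv_val, cycleInv_val]
  simp only [Bool.toNat_false, Bool.toNat_true]
  split_ifs <;> omega

theorem cartesianPower_adj_iff {d : ℕ} (hk : 2 ≤ k) (x y : Fin d → Fin (2 * k)) :
    (cartesianPower (SimpleGraph.cycleGraph (2 * k)) d).Adj x y ↔ ∃ r, y = flip cycleInv r x := by
  simp only [cartesianPower, cycleGraph_adj_iff hk, flip, Function.eq_update_iff, Prod.exists]
  refine exists_congr fun i => ?_
  constructor
  · rintro ⟨⟨s, h⟩, h'⟩
    exact ⟨s, h, fun j hj => (h' j hj).symm⟩
  · rintro ⟨s, h, h'⟩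
    exact ⟨⟨s, h⟩, fun j hj => (h' j hj).symm⟩

end Cycle

/-- Every proper precoloring of at most `2 * d - 1` edges of the `d`-th power of an even cycle
extends to a proper edge coloring with `2 * d` colors. -/
theorem isExtendable_cartesianPower_cycleGraph {k d : ℕ} (hk : 2 ≤ k) (hd : 1 ≤ d)
    {E : Set (Sym2 (Fin d → Fin (2 * k)))} {φ : Sym2 (Fin d → Fin (2 * k)) → Fin (2 * d)}
    (hφ : IsPrecoloring (cartesianPower (SimpleGraph.cycleGraph (2 * k)) d) E φ)
    (hcard : E.ncard ≤ 2 * d - 1) :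
    IsExtendable (cartesianPower (SimpleGraph.cycleGraph (2 * k)) d) E φ := by
  classical
  obtain ⟨hEG, hprop⟩ := hφ
  have hinv := cycleInv_cycleInv (k := k)
  have hne := cycleInv_ne hk
  have hne' := cycleInv_not_ne hk
  have : Nonempty (Fin (2 * d)) := ⟨⟨0, by omega⟩⟩
  have hrep : ∀ e ∈ (cartesianPower (SimpleGraph.cycleGraph (2 * k)) d).edgeSet,
      ∃ p : (Fin d → Fin (2 * k)) × (Fin d × Bool), e = s(p.1, flip cycleInv p.2 p.1) := by
    intro e he
    induction e with
    | _ x y =>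
      obtain ⟨r, rfl⟩ := (cartesianPower_adj_iff hk x y).1 he
      exact ⟨(x, r), rfl⟩
  -- Touching edges of one matching are equal, so `Compatible` expresses properness.
  have hidx : ∀ (v w : Fin d → Fin (2 * k)) (r s : Fin d × Bool),
      Touch cycleInv v r w s →
      (r = s ↔ s(v, flip cycleInv r v) = s(w, flip cycleInv s w)) := by
    intro v w r s hT
    constructor
    · rintro rfl
      rw [Sym2.eq_iff]
      rcases hT with (h | h) | h | h
      · simp [h]
      · right; exact ⟨h, by rw [h, flip_flip hinv]⟩
      · right; exact ⟨by rw [← h, flip_flip hinv], h⟩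
      · left
        exact ⟨by rw [← flip_flip hinv r v, h, flip_flip hinv], h⟩
    · intro h
      rcases Sym2.eq_iff.1 h with ⟨rfl, h⟩ | ⟨h, h'⟩
      · exact flip_injective_index hne hne' h
      · apply flip_injective_index hne hne' (x := v)
        rw [h', h, flip_flip hinv]
  have htouch : ∀ (v w : Fin d → Fin (2 * k)) (r s : Fin d × Bool), Touch cycleInv v r w s ↔
      ∃ z, z ∈ s(v, flip cycleInv r v) ∧ z ∈ s(w, flip cycleInv s w) := by
    intro v w r s
    simp only [Sym2.mem_iff, Touch, or_and_right, exists_or, exists_eq_left]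
  have : Nonempty ((Fin d → Fin (2 * k)) × Fin d × Bool) :=
    ⟨(fun _ => ⟨0, by omega⟩, ⟨0, by omega⟩, false)⟩
  choose! p hp using hrep
  let T := E.toFinite.toFinset.image fun e => ((p e).1, (p e).2, φ e)
  obtain ⟨F, hF, hFT⟩ := exists_isMatchingColoring hinv hne hne' (2 * d) Finset.univ Finset.univ T
    (by simp [mul_comm]) (by simp)
    (Finset.card_image_le.trans (by rwa [← Set.ncard_eq_toFinset_card]))
    (by simp) (by simp) (by
      intro e he e' he' hT
      obtain ⟨e, hE, rfl⟩ := Finset.mem_image.1 he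
      obtain ⟨e', hE', rfl⟩ := Finset.mem_image.1 he'
      replace he := E.toFinite.mem_toFinset.1 hE
      replace he' := E.toFinite.mem_toFinset.1 hE'
      dsimp only at hT ⊢
      rw [hidx _ _ _ _ hT, ← hp e (hEG he), ← hp e' (hEG he')]
      refine ⟨fun h => by rw [h], fun h => ?_⟩
      by_contra hee
      rw [htouch, ← hp e (hEG he), ← hp e' (hEG he')] at hT
      exact hprop e he e' he' hee hT h)
  refine ⟨fun e => F (p e).1 (p e).2, fun e he e' he' hee hz h => hee ?_, fun e he => hFT
    ((p e).1, (p e).2, φ e) (Finset.mem_image.2 ⟨e, E.toFinite.mem_toFinset.2 he, rfl⟩)⟩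
  dsimp only at h
  rw [hp e he, hp e' he', ← htouch] at hz
  rw [hp e he, hp e' he', ← hidx _ _ _ _ hz]
  generalize p e = q at h hz ⊢
  generalize p e' = q' at h hz ⊢
  obtain ⟨v, r⟩ := q
  obtain ⟨w, s⟩ := q'
  dsimp only at h hz ⊢
  have hf := hF.flip v r (Finset.mem_univ _)
  have hf' := hF.flip w s (Finset.mem_univ _)
  -- Colors agree at both ends of an edge, so both can be read at the shared vertex.
  rcases hz with (h1 | h1) | h1 | h1
  · exact hF.inj v r (Finset.mem_univ _) s (Finset.mem_univ _) (by rw [h, h1])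
  · exact hF.inj v r (Finset.mem_univ _) s (Finset.mem_univ _) (by rw [h, h1, hf'])
  · exact hF.inj w r (Finset.mem_univ _) s (Finset.mem_univ _) (by rw [← h, ← h1, hf])
  · exact hF.inj (flip cycleInv r v) r (Finset.mem_univ _) s (Finset.mem_univ _)
      (by rw [hf, h, h1, hf'])

end EdgePrecoloring

theorem theorem3p1 (k d : ℕ) (hk : 2 ≤ k) (hd : 1 ≤ d)
    (E : Set (Sym2 (Fin d → Fin (2 * k)))) (φ : Sym2 (Fin d → Fin (2 * k)) → Fin (2 * d))
    (hφ : EdgePrecoloring.IsPrecoloring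
      (EdgePrecoloring.cartesianPower (SimpleGraph.cycleGraph (2 * k)) d) E φ)
    (hcard : E.ncard ≤ 2 * d - 1) :
    EdgePrecoloring.IsExtendable
      (EdgePrecoloring.cartesianPower (SimpleGraph.cycleGraph (2 * k)) d) E φ :=
  EdgePrecoloring.isExtendable_cartesianPower_cycleGraph hk hd hφ hcard
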